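/- A multiplicative Lie algebra is a group $G$ with a binary operation $\star$ such that, writing ${}^zx=zxz^{-1}$, for all $x,y,z\in G$: $x\star x=e$; $x\star(yz)=(x\star y)\,{}^y(x\star z)$; $(xy)\star z={}^x(y\star z)\,(x\star z)$; $((x\star y)\star{}^yz)\,((y\star z)\star{}^zx)\,((z\star x)\star{}^xy)=e$; ${}^z(x\star y)={}^zx\star{}^zy$. Homomorphisms and automorphisms preserve both operations. For normal subgroups $A,B$ of $G$, $A\star B$ denotes the subgroup generated by all $a\star b$ with $a\in A$, $b\in B$, and $[A,B]$ the usual commutator subgroup. $K$ is called perfect if $K=[K,K](K\star K)$. If $e\to R\to F\to K\to e$ is a free presentation of $K$ (that is, $F$ is a free multiplicative Lie algebra on a set, $F\to K$ is a surjective homomorphism and $R$ is its kernel), the Schur multiplier of $K$ is $$\tilde M(K)=\frac{([F,F](F\star F))\cap R}{[R,F](R\star F)} .$$ Let $e\to H\xrightarrow{i}G\xrightarrow{\beta}K\to e$ be a central extension of multiplicative Lie algebras, that is, a short exact sequence of homomorphisms such that $i(H)$ is contained in the center of the group $G$ and $i(h)\star g=e$ for all $h\in H$, $g\in G$. Assume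 that $K$ is finite and perfect and that $\tilde M(K)$, computed from some free presentation of $K$, is trivial. Then every pair $(\alpha,\eta)\in\mathrm{Aut}(H)\times\mathrm{Aut}(K)$ is inducible: there is an automorphism $\phi$ of the multiplicative Lie algebra $G$ with $\phi(i(H))=i(H)$ such that $\phi(i(h))=i(\alpha(h))$ for all $h\in H$, and $\eta(x)=\beta(\phi(t(x)))$ for all $x\in K$ and every map $t:K\to G$ with $\beta\circ t=\mathrm{id}_K$. -/

import Mathlib

/-- A type with a binary operation `x ⋆ y`. -/
class HasLieStar (G : Type*) where
  lieStar : G → G → G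

infixl:70 " ⋆ " => HasLieStar.lieStar

/-- A multiplicative Lie algebra: a group with an operation `⋆` satisfying the five axioms below,
where the conjugate `ʸz` is `y * z * y⁻¹`. -/
class MultiplicativeLieAlgebra (G : Type*) extends Group G, HasLieStar G where
  star_self : ∀ x : G, x ⋆ x = 1
  star_mul : ∀ x y z : G, x ⋆ (y * z) = (x ⋆ y) * (y * (x ⋆ z) * y⁻¹)
  mul_star : ∀ x y z : G, (x * y) ⋆ z = (x * (y ⋆ z) * x⁻¹) * (x ⋆ z)
  jacobi : ∀ x y z : G,
    ((x ⋆ y) ⋆ (y * z * y⁻¹)) * ((y ⋆ z) ⋆ (z * x * z⁻¹)) * ((z ⋆ x) ⋆ (x * y * x⁻¹)) = 1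
  conj_star : ∀ x y z : G, z * (x ⋆ y) * z⁻¹ = (z * x * z⁻¹) ⋆ (z * y * z⁻¹)

/-- Homomorphisms of multiplicative Lie algebras. -/
structure MLHom (G K : Type*) [MultiplicativeLieAlgebra G] [MultiplicativeLieAlgebra K]
    extends G →* K where
  map_star' : ∀ x y : G, toFun (x ⋆ y) = toFun x ⋆ toFun y

/-- Isomorphisms of multiplicative Lie algebras; `MLEquiv G G` is `Aut(G)`. -/
structure MLEquiv (G K : Type*) [MultiplicativeLieAlgebra G] [MultiplicativeLieAlgebra K]
    extends G ≃* K where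
  map_star' : ∀ x y : G, toFun (x ⋆ y) = toFun x ⋆ toFun y

namespace MLHom

variable {G K : Type*} [MultiplicativeLieAlgebra G] [MultiplicativeLieAlgebra K]

instance : FunLike (MLHom G K) G K where
  coe f := f.toFun
  coe_injective := by
    rintro ⟨f, _⟩ ⟨g, _⟩ h
    have : f = g := DFunLike.coe_injective h
    subst this; rfl

instance : MonoidHomClass (MLHom G K) G K where
  map_mul f := f.toMonoidHom.map_mul
  map_one f := f.toMonoidHom.map_one

theorem map_star (f : MLHom G K) (x y : G) : f (x ⋆ y) = f x ⋆ f y := f.map_star' x y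

/-- The kernel, as a subgroup. -/
def ker (f : MLHom G K) : Subgroup G := f.toMonoidHom.ker

instance (f : MLHom G K) : f.ker.Normal := f.toMonoidHom.normal_ker

end MLHom

namespace MLEquiv

variable {G K : Type*} [MultiplicativeLieAlgebra G] [MultiplicativeLieAlgebra K]

instance : EquivLike (MLEquiv G K) G K where
  coe f := f.toFun
  inv f := f.invFun
  left_inv f := f.left_inv
  right_inv f := f.right_inv
  coe_injective' := by
    rintro ⟨f, _⟩ ⟨g, _⟩ h _
    have : f = g := DFunLike.coe_injective h
    subst this; rfl

instance : MulEquivClass (MLEquiv G K) G K where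
  map_mul f := f.toMulEquiv.map_mul

theorem map_star (f : MLEquiv G K) (x y : G) : f (x ⋆ y) = f x ⋆ f y := f.map_star' x y

end MLEquiv

section StarSubgroup

variable {G : Type*} [MultiplicativeLieAlgebra G]

/-- `A ⋆ B`: the subgroup generated by all `a ⋆ b` with `a ∈ A` and `b ∈ B`. -/
def starSubgroup (A B : Subgroup G) : Subgroup G :=
  Subgroup.closure {g | ∃ a ∈ A, ∃ b ∈ B, a ⋆ b = g}

instance starSubgroup_normal (A B : Subgroup G) [hA : A.Normal] [hB : B.Normal] :
    (starSubgroup A B).Normal := by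
  refine ⟨fun n hn g => ?_⟩
  have h : starSubgroup A B ≤ (starSubgroup A B).comap (MulAut.conj g).toMonoidHom := by
    refine (Subgroup.closure_le _).2 ?_
    rintro _ ⟨a, ha, b, hb, rfl⟩
    refine Subgroup.subset_closure ⟨g * a * g⁻¹, hA.conj_mem a ha g, g * b * g⁻¹,
      hB.conj_mem b hb g, ?_⟩
    exact (MultiplicativeLieAlgebra.conj_star a b g).symm
  exact h hn

/-- `[A, B](A ⋆ B)`. It is only used for normal `A` and `B`; then both factors are normal, so that
their join is the set of products. -/
def commStar (A B : Subgroup G) : Subgroup G := ⁅A, B⁆ ⊔ starSubgroup A B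

instance commStar_normal (A B : Subgroup G) [A.Normal] [B.Normal] : (commStar A B).Normal := by
  unfold commStar; infer_instance

end StarSubgroup

/-- `K` is perfect if `K = [K, K](K ⋆ K)`. -/
def IsPerfectML (K : Type*) [MultiplicativeLieAlgebra K] : Prop :=
  commStar (⊤ : Subgroup K) ⊤ = ⊤

namespace FreeML

/-- Formal expressions in the operations of a multiplicative Lie algebra with variables in `X`. -/
inductive Pre (X : Type*)
  | of : X → Pre X
  | one : Pre X
  | mul : Pre X → Pre X → Pre X
  | inv : Pre X → Pre X
  | star : Pre X → Pre X → Pre X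

namespace Pre

instance (X : Type*) : One (Pre X) := ⟨one⟩
instance (X : Type*) : Mul (Pre X) := ⟨mul⟩
instance (X : Type*) : Inv (Pre X) := ⟨inv⟩
instance (X : Type*) : HasLieStar (Pre X) := ⟨star⟩

end Pre

/-- The smallest congruence on formal expressions that contains the group axioms and the axioms of
a multiplicative Lie algebra. -/
inductive Rel (X : Type*) : Pre X → Pre X → Prop
  | refl (a) : Rel X a a
  | symm {a b} : Rel X a b → Rel X b a
  | trans {a b c} : Rel X a b → Rel X b c → Rel X a c
  | mul_congr {a a' b b'} : Rel X a a' → Rel X b b' → Rel X (a * b) (a' * b')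
  | inv_congr {a a'} : Rel X a a' → Rel X a⁻¹ a'⁻¹
  | star_congr {a a' b b'} : Rel X a a' → Rel X b b' → Rel X (a ⋆ b) (a' ⋆ b')
  | mul_assoc (a b c) : Rel X (a * b * c) (a * (b * c))
  | one_mul (a) : Rel X (1 * a) a
  | inv_mul_cancel (a) : Rel X (a⁻¹ * a) 1
  | star_self (x) : Rel X (x ⋆ x) 1
  | star_mul (x y z) : Rel X (x ⋆ (y * z)) ((x ⋆ y) * (y * (x ⋆ z) * y⁻¹))
  | mul_star (x y z) : Rel X ((x * y) ⋆ z) ((x * (y ⋆ z) * x⁻¹) * (x ⋆ z))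
  | jacobi (x y z) : Rel X
      (((x ⋆ y) ⋆ (y * z * y⁻¹)) * ((y ⋆ z) ⋆ (z * x * z⁻¹)) * ((z ⋆ x) ⋆ (x * y * x⁻¹))) 1
  | conj_star (x y z) : Rel X (z * (x ⋆ y) * z⁻¹) ((z * x * z⁻¹) ⋆ (z * y * z⁻¹))

/-- The congruence as a setoid. -/
def relSetoid (X : Type*) : Setoid (Pre X) := ⟨Rel X, Rel.refl, Rel.symm, Rel.trans⟩

end FreeML

/-- The free multiplicative Lie algebra on `X`. -/
def FreeML (X : Type*) : Type _ := Quotient (FreeML.relSetoid X)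

namespace FreeML

variable {X : Type*}

instance : One (FreeML X) := ⟨Quotient.mk _ 1⟩
instance : Mul (FreeML X) :=
  ⟨Quotient.map₂ (· * ·) fun _ _ h _ _ h' => Rel.mul_congr h h'⟩
instance : Inv (FreeML X) := ⟨Quotient.map (·⁻¹) fun _ _ h => Rel.inv_congr h⟩
instance : HasLieStar (FreeML X) :=
  ⟨Quotient.map₂ (· ⋆ ·) fun _ _ h _ _ h' => Rel.star_congr h h'⟩

instance : Group (FreeML X) :=
  Group.ofLeftAxioms
    (by rintro ⟨a⟩ ⟨b⟩ ⟨c⟩; exact Quotient.sound (Rel.mul_assoc a b c))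
    (by rintro ⟨a⟩; exact Quotient.sound (Rel.one_mul a))
    (by rintro ⟨a⟩; exact Quotient.sound (Rel.inv_mul_cancel a))

instance : MultiplicativeLieAlgebra (FreeML X) where
  star_self := by rintro ⟨x⟩; exact Quotient.sound (Rel.star_self x)
  star_mul := by rintro ⟨x⟩ ⟨y⟩ ⟨z⟩; exact Quotient.sound (Rel.star_mul x y z)
  mul_star := by rintro ⟨x⟩ ⟨y⟩ ⟨z⟩; exact Quotient.sound (Rel.mul_star x y z)
  jacobi := by rintro ⟨x⟩ ⟨y⟩ ⟨z⟩; exact Quotient.sound (Rel.jacobi x y z)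
  conj_star := by rintro ⟨x⟩ ⟨y⟩ ⟨z⟩; exact Quotient.sound (Rel.conj_star x y z)

/-- The canonical generators. -/
def of (x : X) : FreeML X := Quotient.mk _ (Pre.of x)

variable {G : Type*} [MultiplicativeLieAlgebra G]

/-- Evaluation of a formal expression. -/
def evalPre (f : X → G) : Pre X → G
  | .of x => f x
  | .one => 1
  | .mul a b => evalPre f a * evalPre f b
  | .inv a => (evalPre f a)⁻¹
  | .star a b => evalPre f a ⋆ evalPre f b

theorem evalPre_eq_of_rel (f : X → G) {a b : Pre X} (h : Rel X a b) :
    evalPre f a = evalPre f b := by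
  induction h with
  | refl => rfl
  | symm _ ih => exact ih.symm
  | trans _ _ h₁ h₂ => exact h₁.trans h₂
  | mul_congr _ _ h₁ h₂ => exact congrArg₂ (· * ·) h₁ h₂
  | inv_congr _ h => exact congrArg (·⁻¹) h
  | star_congr _ _ h₁ h₂ => exact congrArg₂ (· ⋆ ·) h₁ h₂
  | mul_assoc a b c => exact _root_.mul_assoc (evalPre f a) (evalPre f b) (evalPre f c)
  | one_mul a => exact _root_.one_mul (evalPre f a)
  | inv_mul_cancel a => exact _root_.inv_mul_cancel (evalPre f a)
  | star_self x => exact MultiplicativeLieAlgebra.star_self (evalPre f x)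
  | star_mul x y z =>
    exact MultiplicativeLieAlgebra.star_mul (evalPre f x) (evalPre f y) (evalPre f z)
  | mul_star x y z =>
    exact MultiplicativeLieAlgebra.mul_star (evalPre f x) (evalPre f y) (evalPre f z)
  | jacobi x y z =>
    exact MultiplicativeLieAlgebra.jacobi (evalPre f x) (evalPre f y) (evalPre f z)
  | conj_star x y z =>
    exact MultiplicativeLieAlgebra.conj_star (evalPre f x) (evalPre f y) (evalPre f z)

/-- The homomorphism out of the free multiplicative Lie algebra extending `f`. -/
def lift (f : X → G) : MLHom (FreeML X) G where
  toFun := Quotient.lift (evalPre f) fun _ _ h => evalPre_eq_of_rel f h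
  map_one' := rfl
  map_mul' := by rintro ⟨a⟩ ⟨b⟩; rfl
  map_star' := by rintro ⟨a⟩ ⟨b⟩; rfl

/-- The universal property. -/
theorem existsUnique_lift (f : X → G) : ∃! φ : MLHom (FreeML X) G, ∀ x, φ (of x) = f x := by
  refine ⟨lift f, fun _ => rfl, fun φ hφ => DFunLike.ext _ _ ?_⟩
  have hmul (a b : FreeML X) : φ (a * b) = φ a * φ b := map_mul φ a b
  have hinv (a : FreeML X) : φ a⁻¹ = (φ a)⁻¹ := map_inv φ a
  rintro ⟨a⟩
  induction a with
  | of x => exact hφ x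
  | one => exact map_one φ
  | mul a b ha hb =>
    exact (hmul (Quotient.mk _ a) (Quotient.mk _ b)).trans
      (congrArg₂ (· * ·) ha hb)
  | inv a ha => exact (hinv (Quotient.mk _ a)).trans (congrArg (·⁻¹) ha)
  | star a b ha hb =>
    exact (φ.map_star (Quotient.mk _ a) (Quotient.mk _ b)).trans
      (congrArg₂ (· ⋆ ·) ha hb)

end FreeML

universe w

/-- A free presentation `1 → R → F → K → 1` of `K`: a set `gens` and a surjective homomorphism `ν`
from the free multiplicative Lie algebra `F` on `gens` onto `K`; here `R` is the kernel of `ν`. -/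
structure FreePresentation (K : Type*) [MultiplicativeLieAlgebra K] where
  gens : Type w
  ν : MLHom (FreeML gens) K
  surjective : Function.Surjective ν

namespace FreePresentation

variable {K : Type*} [MultiplicativeLieAlgebra K]

/-- The kernel `R` of the presentation. -/
def R (P : FreePresentation.{w} K) : Subgroup (FreeML P.gens) := P.ν.ker

instance (P : FreePresentation.{w} K) : P.R.Normal := inferInstanceAs P.ν.ker.Normal

/-- The numerator `([F, F](F ⋆ F)) ∩ R` of the Schur multiplier. -/
def num (P : FreePresentation.{w} K) : Subgroup (FreeML P.gens) := commStar ⊤ ⊤ ⊓ P.R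

/-- The denominator `[R, F](R ⋆ F)` of the Schur multiplier. -/
def den (P : FreePresentation.{w} K) : Subgroup (FreeML P.gens) := commStar P.R ⊤

instance (P : FreePresentation.{w} K) : P.den.Normal := inferInstanceAs (commStar P.R ⊤).Normal

end FreePresentation

/-- Every multiplicative Lie algebra has a free presentation. -/
def FreePresentation.standard (K : Type w) [MultiplicativeLieAlgebra K] :
    FreePresentation.{w} K where
  gens := K
  ν := FreeML.lift id
  surjective := fun x => ⟨FreeML.of x, rfl⟩

/-- The Schur multiplier `(([F, F](F ⋆ F)) ∩ R) / ([R, F](R ⋆ F))` of `K`, computed from a free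
presentation of `K`. -/
abbrev SchurMultiplier {K : Type*} [MultiplicativeLieAlgebra K] (P : FreePresentation.{w} K) :
    Type _ :=
  P.num ⧸ P.den.subgroupOf P.num

section Extension

variable {H G K : Type*} [MultiplicativeLieAlgebra H] [MultiplicativeLieAlgebra G]
  [MultiplicativeLieAlgebra K]

/-- `1 → H → G → K → 1` is exact and the image of `H` lies in the intersection of the centre of the
group `G` and of the multiplicative centre `{x | ∀ y, x ⋆ y = 1}`. -/
structure IsCentralExtension (i : MLHom H G) (β : MLHom G K) : Prop where
  injective : Function.Injective i
  exact : ∀ g : G, β g = 1 ↔ g ∈ Set.range i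
  surjective : Function.Surjective β
  center : ∀ h : H, i h ∈ Subgroup.center G
  starCenter : ∀ (h : H) (g : G), i h ⋆ g = 1

/-- `(α, η)` is inducible: some automorphism `φ` of `G` with `φ(H) = H` restricts to `α` on `H` and
induces `η` on `K`, i.e. `η x = β (φ (t x))` for every (equivalently, one) transversal `t`. -/
def IsInducible (i : MLHom H G) (β : MLHom G K) (α : MLEquiv H H) (η : MLEquiv K K) : Prop :=
  ∃ φ : MLEquiv G G, φ '' Set.range i = Set.range i ∧ (∀ h : H, φ (i h) = i (α h)) ∧
    ∀ t : K → G, (∀ x, β (t x) = x) → ∀ x, η x = β (φ (t x))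

end Extension

/-! The extension splits, and in a split extension the two automorphisms act componentwise. For the
splitting (`exists_section`), lift `ν : F → K` through `β` to `f : F → G`. It sends `R` into `i(H)`,
which is central for both operations, so `f` kills `[R,F](R⋆F)`. As the multiplier is trivial, `f`
then kills `[F,F](F⋆F) ∩ R`, so on `[F,F](F⋆F)` its value depends only on the image in `K`.
Perfectness makes that image all of `K`, and a section `s` results. Every element of `G` is then
uniquely `i h * s k`, and the star sees only the `K`-components, so `i h * s k ↦ i (α h) * s (η k)`
is the required automorphism (`isInducible_of_section`). -/

section StarOperation

variable {G : Type*} [MultiplicativeLieAlgebra G]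

/-- Expanding `(x * y) ⋆ (x * y) = 1` and cancelling `x ⋆ x` and `y ⋆ y` leaves a conjugate of the
product by `x`. -/
theorem star_mul_star_swap (x y : G) : (y ⋆ x) * (x ⋆ y) = 1 := by
  have h := MultiplicativeLieAlgebra.star_self (x * y)
  rw [MultiplicativeLieAlgebra.mul_star, MultiplicativeLieAlgebra.star_mul,
    MultiplicativeLieAlgebra.star_mul, MultiplicativeLieAlgebra.star_self,
    MultiplicativeLieAlgebra.star_self] at h
  have h' : x * ((y ⋆ x) * (x ⋆ y)) * x⁻¹ = 1 := by
    rw [← h]; group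
  exact conj_eq_one_iff.1 h'

theorem star_eq_one_comm {x y : G} (h : x ⋆ y = 1) : y ⋆ x = 1 := by
  simpa [h] using star_mul_star_swap x y

theorem star_mem_commStar {A B : Subgroup G} {a b : G} (ha : a ∈ A) (hb : b ∈ B) :
    a ⋆ b ∈ commStar A B :=
  (le_sup_right : starSubgroup A B ≤ commStar A B)
    (Subgroup.subset_closure ⟨a, ha, b, hb, rfl⟩)

end StarOperation

section Maps

variable {G K : Type*} [MultiplicativeLieAlgebra G] [MultiplicativeLieAlgebra K]

/-- A homomorphism annihilates `[A, B](A ⋆ B)` if it does so on commutators and stars. -/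
theorem commStar_le_ker (f : MLHom G K) {A B : Subgroup G}
    (hcomm : ∀ a ∈ A, ∀ b ∈ B, f a * f b = f b * f a)
    (hstar : ∀ a ∈ A, ∀ b ∈ B, f a ⋆ f b = 1) : commStar A B ≤ f.ker := by
  refine sup_le (Subgroup.commutator_le.2 fun a ha b hb => ?_) ((Subgroup.closure_le _).2 ?_)
  · refine (map_commutatorElement f.toMonoidHom a b).trans ?_
    exact commutatorElement_eq_one_iff_mul_comm.2 (hcomm a ha b hb)
  · rintro _ ⟨a, ha, b, hb, rfl⟩
    exact (f.map_star a b).trans (hstar a ha b hb)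

/-- A surjective homomorphism onto a perfect algebra is surjective on `[G, G](G ⋆ G)`. -/
theorem IsPerfectML.exists_mem_commStar (hK : IsPerfectML K) (f : MLHom G K)
    (hf : Function.Surjective f) (x : K) : ∃ c ∈ commStar (⊤ : Subgroup G) ⊤, f c = x := by
  have h : commStar (⊤ : Subgroup K) ⊤ ≤ (commStar (⊤ : Subgroup G) ⊤).map f.toMonoidHom := by
    refine sup_le (Subgroup.commutator_le.2 fun a _ b _ => ?_) ((Subgroup.closure_le _).2 ?_)
    · obtain ⟨a, rfl⟩ := hf a
      obtain ⟨b, rfl⟩ := hf b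
      exact ⟨_, (le_sup_left : ⁅(⊤ : Subgroup G), ⊤⁆ ≤ commStar ⊤ ⊤)
        (Subgroup.commutator_mem_commutator (Subgroup.mem_top a) (Subgroup.mem_top b)),
        map_commutatorElement f.toMonoidHom a b⟩
    · rintro _ ⟨a, -, b, -, rfl⟩
      obtain ⟨a, rfl⟩ := hf a
      obtain ⟨b, rfl⟩ := hf b
      exact ⟨a ⋆ b, star_mem_commStar trivial trivial, f.map_star a b⟩
  have hK' : commStar (⊤ : Subgroup K) ⊤ = ⊤ := hK
  rw [hK'] at h
  exact h (Subgroup.mem_top x)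

/-- A homomorphism from a free algebra lifts along a surjective homomorphism. -/
theorem FreeML.exists_comp_eq {X : Type*} (ν : MLHom (FreeML X) K) (β : MLHom G K)
    (hβ : Function.Surjective β) : ∃ f : MLHom (FreeML X) G, ∀ a, β (f a) = ν a := by
  choose l hl using fun x => hβ (ν (FreeML.of x))
  obtain ⟨f, hf, -⟩ := FreeML.existsUnique_lift l
  -- The composite `β ∘ f` is bundled so that uniqueness in the universal property identifies it
  -- with `ν`.
  let g : MLHom (FreeML X) K :=
    { β.toMonoidHom.comp f.toMonoidHom with
      map_star' := fun x y => (congrArg β (f.map_star x y)).trans (β.map_star _ _) }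
  refine ⟨f, fun a => ?_⟩
  have hg : g = ν := (FreeML.existsUnique_lift fun x => ν (FreeML.of x)).unique
    (fun x => (congrArg β (hf x)).trans (hl x)) (fun _ => rfl)
  exact DFunLike.congr_fun hg a

end Maps

/-! ### Splitting of central extensions and inducibility -/

namespace IsCentralExtension

variable {H G K : Type*} [MultiplicativeLieAlgebra H] [MultiplicativeLieAlgebra G]
  [MultiplicativeLieAlgebra K] {i : MLHom H G} {β : MLHom G K}

theorem map_inclusion (hE : IsCentralExtension i β) (h : H) : β (i h) = 1 :=
  (hE.exact _).2 ⟨h, rfl⟩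

theorem inclusion_comm (hE : IsCentralExtension i β) (h : H) (g : G) : i h * g = g * i h :=
  (Subgroup.mem_center_iff.1 (hE.center h) g).symm

/-- Together with `star_inclusion_mul`, this makes the star of two elements of `G` depend only on
their images in `K`. -/
theorem inclusion_mul_star (hE : IsCentralExtension i β) (h : H) (x y : G) :
    (i h * x) ⋆ y = x ⋆ y := by
  rw [MultiplicativeLieAlgebra.mul_star, hE.starCenter, hE.inclusion_comm]
  simp

theorem star_inclusion_mul (hE : IsCentralExtension i β) (h : H) (x y : G) :
    x ⋆ (i h * y) = x ⋆ y := by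
  rw [MultiplicativeLieAlgebra.star_mul, star_eq_one_comm (hE.starCenter h x),
    hE.inclusion_comm]
  simp

/-- A central extension of a perfect algebra with trivial Schur multiplier splits. -/
theorem exists_section (hE : IsCentralExtension i β) (hK : IsPerfectML K)
    (P : FreePresentation.{w} K) (hM : Subsingleton (SchurMultiplier P)) :
    ∃ s : MLHom K G, ∀ x, β (s x) = x := by
  obtain ⟨f, hf⟩ := FreeML.exists_comp_eq P.ν β hE.surjective
  have hR : ∀ r ∈ P.R, ∃ h, i h = f r := fun r hr =>
    (hE.exact _).1 ((hf r).trans hr)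
  have hden : P.den ≤ f.ker := by
    refine commStar_le_ker f (fun r hr b _ => ?_) fun r hr b _ => ?_
    · obtain ⟨h, hh⟩ := hR r hr
      rw [← hh, hE.inclusion_comm]
    · obtain ⟨h, hh⟩ := hR r hr
      rw [← hh, hE.starCenter]
  have hnum : P.num ≤ P.den :=
    Subgroup.subgroupOf_eq_top.1 (QuotientGroup.subsingleton_iff.1 hM)
  -- Elements of `[F,F](F⋆F)` with equal image in `K` differ by an element of the numerator, which
  -- `f` kills.
  have hwd {a b : FreeML P.gens} (ha : a ∈ commStar ⊤ ⊤) (hb : b ∈ commStar ⊤ ⊤)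
      (hab : P.ν a = P.ν b) : f a = f b := by
    have hmem : a * b⁻¹ ∈ P.num := by
      refine ⟨Subgroup.mul_mem _ ha (Subgroup.inv_mem _ hb), ?_⟩
      change P.ν (a * b⁻¹) = 1
      rw [map_mul, map_inv, hab, mul_inv_cancel]
    have h1 : f (a * b⁻¹) = 1 := hden (hnum hmem)
    rwa [map_mul, map_inv, mul_inv_eq_one] at h1
  -- The preimages `c x` are arbitrary. Since `[F,F](F⋆F)` is closed under both operations, `hwd`
  -- makes `f ∘ c` respect them.
  choose c hc hνc using hK.exists_mem_commStar P.ν P.surjective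
  refine ⟨{ MonoidHom.mk' (fun x => f (c x)) fun x y => ?_ with
    map_star' := fun x y => ?_ }, fun x => (hf _).trans (hνc x)⟩
  · rw [← map_mul]
    exact hwd (hc _) (mul_mem (hc _) (hc _)) (by rw [map_mul, hνc, hνc, hνc])
  · change f (c (x ⋆ y)) = f (c x) ⋆ f (c y)
    rw [← f.map_star]
    exact hwd (hc _) (star_mem_commStar trivial trivial) (by rw [P.ν.map_star, hνc, hνc, hνc])

/-- Every pair of automorphisms is inducible in a split central extension. -/
theorem isInducible_of_section (hE : IsCentralExtension i β) (s : MLHom K G)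
    (hs : ∀ x, β (s x) = x) (α : MLEquiv H H) (η : MLEquiv K K) : IsInducible i β α η := by
  have hdecomp (g : G) : ∃ h, i h * s (β g) = g := by
    obtain ⟨h, hh⟩ := (hE.exact (g * (s (β g))⁻¹)).1 (by rw [map_mul, map_inv, hs, mul_inv_cancel])
    exact ⟨h, by rw [hh, inv_mul_cancel_right]⟩
  -- `p g` is the `H`-component of `g`, and `β g` is its `K`-component.
  choose p hp using hdecomp
  have hβ (h : H) (k : K) : β (i h * s k) = k := by
    rw [map_mul, hE.map_inclusion, hs, one_mul]
  have hpi (h : H) (k : K) : p (i h * s k) = h := by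
    have h1 := hp (i h * s k)
    rw [hβ] at h1
    exact hE.injective (mul_right_cancel h1)
  let φ (g : G) : G := i (α (p g)) * s (η (β g))
  have hφ (h : H) (k : K) : φ (i h * s k) = i (α h) * s (η k) := by
    simp only [φ, hpi, hβ]
  have hmul4 (a b : H) (x y : K) : i a * s x * (i b * s y) = i (a * b) * s (x * y) := by
    rw [map_mul, map_mul, mul_assoc, ← mul_assoc (s x), ← hE.inclusion_comm b (s x)]
    simp only [mul_assoc]
  have hφmul (x y : G) : φ (x * y) = φ x * φ y := by
    rw [← hp x, ← hp y, hmul4, hφ, hφ, hφ, hmul4, map_mul α, map_mul η]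
  have hφi (h : H) : φ (i h) = i (α h) := by
    simpa using hφ h 1
  have hβφ (g : G) : β (φ g) = η (β g) := hβ _ _
  -- The `H`-components drop out of a star, so only stars inside `s(K)` matter, and there `φ` acts
  -- as `η`.
  have hφstar (x y : G) : φ (x ⋆ y) = φ x ⋆ φ y := by
    have hs1 (k : K) : φ (s k) = s (η k) := by simpa using hφ 1 k
    rw [← hp x, ← hp y, hφ, hφ]
    simp only [hE.inclusion_mul_star, hE.star_inclusion_mul]
    rw [← s.map_star, hs1, η.map_star, s.map_star]
  have hinj : Function.Injective φ := by
    -- By `hβφ` and injectivity of `η`, the kernel of `φ` lies in `i(H)`, where `φ` acts as the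
    -- injective map `α`.
    refine (injective_iff_map_eq_one (MonoidHom.mk' φ hφmul)).2 fun g hg => ?_
    have hg : φ g = 1 := hg
    have hβg : β g = 1 := by
      have h1 := hβφ g
      rw [hg, map_one] at h1
      exact (map_eq_one_iff η (EquivLike.injective η)).1 h1.symm
    obtain ⟨h, rfl⟩ := (hE.exact g).1 hβg
    rw [hφi, map_eq_one_iff i hE.injective, map_eq_one_iff α (EquivLike.injective α)] at hg
    rw [hg, map_one]
  have hsurj : Function.Surjective φ := fun g => by
    obtain ⟨a, ha⟩ := EquivLike.surjective α (p g)
    obtain ⟨k, hk⟩ := EquivLike.surjective η (β g)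
    exact ⟨i a * s k, by rw [hφ, ha, hk, hp]⟩
  refine ⟨{ MulEquiv.ofBijective (MonoidHom.mk' φ hφmul) ⟨hinj, hsurj⟩ with
    map_star' := hφstar }, ?_, hφi, fun t ht x => ?_⟩
  · change φ '' Set.range i = Set.range i
    rw [← Set.range_comp]
    have hcomp : φ ∘ i = i ∘ α := funext hφi
    rw [hcomp, (EquivLike.surjective α).range_comp]
  · exact ((hβφ (t x)).trans (congrArg η (ht x))).symm

end IsCentralExtension

theorem corollary3p13 {H G K : Type*} [MultiplicativeLieAlgebra H] [MultiplicativeLieAlgebra G]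
    [MultiplicativeLieAlgebra K] [Finite K]
    (i : MLHom H G) (β : MLHom G K) (hE : IsCentralExtension i β)
    (hK : IsPerfectML K)
    (P : FreePresentation.{w} K) (hM : Subsingleton (SchurMultiplier P))
    (α : MLEquiv H H) (η : MLEquiv K K) :
    IsInducible i β α η := by
  obtain ⟨s, hs⟩ := hE.exists_section hK P hM
  exact hE.isInducible_of_section s hs α η
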